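/- **Proposition 4.1.** Let $\Omega\subset\mathbb R^n$ be a bounded open set with Lipschitz boundary and let $\Gamma\subset\partial\Omega$ be measurable with positive surface measure. Let $H^{1/2}(\Gamma)$ be the space of traces on $\Gamma$ of functions of $H^1(\Omega)$, with norm $\|g\|=\inf\{\|u\|_{H^1(\Omega)}:\gamma_0u=g\text{ on }\Gamma\}$, and let $\chi_\Gamma\gamma_0:H^1(\Omega)\to H^{1/2}(\Gamma)$ be the trace on $\Gamma$. Consider $$\frac{\partial x}{\partial t}=Ax+Bu\ \text{ in }\Omega\times(0,\infty),\qquad x(0)=x_0,\qquad \frac{\partial x}{\partial\nu_A}=0\ \text{ on }\partial\Omega\times(0,\infty),\qquad y(t)=Cx(t),$$ where $Ax=\sum_{i,j}\partial_i(a_{ij}\partial_jx)+a_0x$ has bounded measurable coefficients, with $(a_{ij})$ symmetric and uniformly elliptic on $\Omega$, the Neumann condition is included in the domain of $A$, $A$ generates the strongly continuous semigroup $(S_A(t))_{t\ge0}$ on the state space $H^1(\Omega)$, $B:\mathbb R^p\to H^1(\Omega)$ and $C:H^1(\Omega)\to\mathbb R^q$ are bounded linear operators, and $u\in L^2(0,\infty;\mathbb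 R^p)$. The solution is $$x(t)=S_A(t)x_0+\int_0^tS_A(t-\tau)Bu(\tau)\,d\tau .$$ A bounded linear operator $H_\Gamma:\mathbb R^q\to H^{1/2}(\Gamma)$, realized in the state space by a bounded linear operator $H:\mathbb R^q\to H^1(\Omega)$ with $\chi_\Gamma\gamma_0H=H_\Gamma$, is called a *detecting gain* if $A-HC$ generates a strongly continuous semigroup $(S_H(t))_{t\ge0}$ on $H^1(\Omega)$ and there are $M,\alpha>0$ with $\|\chi_\Gamma\gamma_0S_H(t)\|_{L(H^1(\Omega),H^{1/2}(\Gamma))}\le Me^{-\alpha t}$ for all $t\ge0$. The system is *$\Gamma_{EFO}$-detectable* if a detecting gain exists. The Luenberger system with gain $H_\Gamma$ is $$\frac{\partial\hat z}{\partial t}=A\hat z+Bu+H(y-C\hat z)\ \text{ in }\Omega\times(0,\infty),\qquad \hat z(0)=\hat z_0,\qquad \frac{\partial\hat z}{\partial\nu_A}=0\ \text{ on }\partial\Omega\times(0,\infty),$$ with solution $\hat z(t)=S_H(t)\hat z_0+\int_0^tS_H(t-\tau)\,[Bu(\tau)+Hy(\tau)]\,d\tau$. If the system is $\Gamma_{EFO}$-detectable,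 then the Luenberger system is a full-order regional exponential estimator on $\Gamma$ for some detecting gain, and indeed for every one: for each detecting gain there are $M,\alpha>0$ such that, for all $u\in L^2(0,\infty;\mathbb R^p)$ and all $x_0,\hat z_0\in H^1(\Omega)$ (in particular for $\hat z_0=0$), $$\|\chi_\Gamma\gamma_0(x(t)-\hat z(t))\|_{H^{1/2}(\Gamma)}\le Me^{-\alpha t}\|x_0-\hat z_0\|_{H^1(\Omega)}\quad(t\ge0),\qquad \lim_{t\to\infty}\|\chi_\Gamma\gamma_0(x(t)-\hat z(t))\|_{H^{1/2}(\Gamma)}=0 .$$ -/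

import Mathlib

open MeasureTheory Filter Topology
open scoped ContDiff

noncomputable section

namespace RegionalBoundary

/-! ### Domains and boundary regions -/

/-- `ℝⁿ` with the Euclidean norm. -/
abbrev E (n : ℕ) : Type := EuclideanSpace ℝ (Fin n)

/-- A regular bounded domain: a bounded open set with Lipschitz boundary. Near each boundary point
`p` there are a unit vector `e` and a Lipschitz function `φ` such that `Ω` is the strict epigraph of
`φ` in the direction `e` (`x - ⟪e, x⟫ e` is the component of `x` orthogonal to `e`). -/
structure IsRegularDomain {n : ℕ} (Ω : Set (E n)) : Prop where
  isOpen : IsOpen Ω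
  isBounded : Bornology.IsBounded Ω
  lipschitz_boundary : ∀ p ∈ frontier Ω, ∃ e : E n, ‖e‖ = 1 ∧ ∃ (L : NNReal) (φ : E n → ℝ),
    LipschitzWith L φ ∧ ∃ r > 0, ∀ x ∈ Metric.ball p r,
      (x ∈ Ω ↔ φ (x - inner ℝ e x • e) < inner ℝ e x)

/-- The surface measure of `ℝⁿ` restricted to `Γ`: `(n - 1)`-dimensional Hausdorff measure. -/
def surfaceMeasure {n : ℕ} (Γ : Set (E n)) : Measure (E n) :=
  (Measure.hausdorffMeasure ((n : ℝ) - 1)).restrict Γ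

/-- A sub-region `Γ` of `∂Ω`: a measurable part of the boundary of positive surface measure. -/
structure IsBoundaryRegion {n : ℕ} (Ω Γ : Set (E n)) : Prop where
  measurableSet : MeasurableSet Γ
  subset_frontier : Γ ⊆ frontier Ω
  measure_pos : 0 < surfaceMeasure Γ Set.univ

/-! ### The Sobolev space `H¹(Ω)` -/

section Sobolev

variable {n : ℕ}

/-- `L²(Ω)`. -/
abbrev L2 (Ω : Set (E n)) : Type := Lp ℝ 2 (volume.restrict Ω)

/-- `L²(Ω; ℝⁿ)`. -/
abbrev L2Vec (Ω : Set (E n)) : Type := Lp (E n) 2 (volume.restrict Ω)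

/-- `G` is the weak gradient of `u` on `Ω`. -/
def IsWeakGradient (Ω : Set (E n)) (u : E n → ℝ) (G : E n → E n) : Prop :=
  ∀ φ : E n → ℝ, ContDiff ℝ ∞ φ → HasCompactSupport φ → tsupport φ ⊆ Ω → ∀ e : E n,
    ∫ x in Ω, u x * fderiv ℝ φ x e = -∫ x in Ω, inner ℝ (G x) e * φ x

lemma memLp_of_compactSupport {F : Type*} [NormedAddCommGroup F] (Ω : Set (E n)) {ψ : E n → F}
    (hψ : Continuous ψ) (hc : HasCompactSupport ψ) : MemLp ψ 2 (volume.restrict Ω) :=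
  (hψ.memLp_of_hasCompactSupport hc).restrict Ω

/-- The weak gradient equation for one test function, as the vanishing of a bounded functional. -/
lemma exists_weakGradient_functional (Ω : Set (E n)) {φ : E n → ℝ} (hφ : ContDiff ℝ ∞ φ)
    (hc : HasCompactSupport φ) (e : E n) :
    ∃ Λ : WithLp 2 (L2 Ω × L2Vec Ω) →L[ℝ] ℝ, ∀ w : WithLp 2 (L2 Ω × L2Vec Ω),
      (∫ x in Ω, w.fst x * fderiv ℝ φ x e = -∫ x in Ω, inner ℝ (w.snd x) e * φ x) ↔ Λ w = 0 := by
  have hcont : Continuous (fun x => fderiv ℝ φ x e) :=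
    (hφ.continuous_fderiv (by simp)).clm_apply continuous_const
  have hcs : HasCompactSupport (fun x => fderiv ℝ φ x e) := hc.fderiv_apply ℝ e
  have h1 := memLp_of_compactSupport Ω hcont hcs
  have hcont2 : Continuous (fun x => φ x • e) := hφ.continuous.smul continuous_const
  have h2 := memLp_of_compactSupport Ω hcont2 (hc.smul_right (f' := fun _ => e))
  refine ⟨(innerSL ℝ (h1.toLp _)).comp (WithLp.fstL 2 ℝ (L2 Ω) (L2Vec Ω))
    + (innerSL ℝ (h2.toLp _)).comp (WithLp.sndL 2 ℝ (L2 Ω) (L2Vec Ω)), fun w => ?_⟩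
  have e1 : inner ℝ (h1.toLp _) w.fst = ∫ x in Ω, w.fst x * fderiv ℝ φ x e := by
    rw [L2.inner_def]
    refine integral_congr_ae ?_
    filter_upwards [h1.coeFn_toLp] with x hx
    rw [hx]; simp
  have e2 : inner ℝ (h2.toLp _) w.snd = ∫ x in Ω, inner ℝ (w.snd x) e * φ x := by
    rw [L2.inner_def]
    refine integral_congr_ae ?_
    filter_upwards [h2.coeFn_toLp] with x hx
    rw [hx, inner_smul_left, real_inner_comm]; simp [mul_comm]
  have : ((innerSL ℝ (h1.toLp _)).comp (WithLp.fstL 2 ℝ (L2 Ω) (L2Vec Ω))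
    + (innerSL ℝ (h2.toLp _)).comp (WithLp.sndL 2 ℝ (L2 Ω) (L2Vec Ω))) w
      = inner ℝ (h1.toLp _) w.fst + inner ℝ (h2.toLp _) w.snd := by
    simp
  rw [this, e1, e2, eq_neg_iff_add_eq_zero]

/-- `H¹(Ω)`, as the set of pairs `(u, ∇u)` in `L²(Ω) × L²(Ω; ℝⁿ)` with `∇u` the weak gradient of
`u`; its norm is `(‖u‖² + ‖∇u‖²)^{1/2}`. -/
def sobolevH1 (Ω : Set (E n)) : Submodule ℝ (WithLp 2 (L2 Ω × L2Vec Ω)) where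
  carrier := {w | IsWeakGradient Ω w.fst w.snd}
  add_mem' := by
    intro v w hv hw φ hφ hc hs e
    obtain ⟨Λ, hΛ⟩ := exists_weakGradient_functional Ω hφ hc e
    rw [hΛ, map_add, (hΛ v).1 (hv φ hφ hc hs e), (hΛ w).1 (hw φ hφ hc hs e), add_zero]
  zero_mem' := by
    intro φ hφ hc hs e
    obtain ⟨Λ, hΛ⟩ := exists_weakGradient_functional Ω hφ hc e
    rw [hΛ, map_zero]
  smul_mem' := by
    intro c w hw φ hφ hc hs e
    obtain ⟨Λ, hΛ⟩ := exists_weakGradient_functional Ω hφ hc e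
    rw [hΛ, map_smul, (hΛ w).1 (hw φ hφ hc hs e), smul_zero]

/-- The Hilbert space `H¹(Ω)`. -/
abbrev H1 (Ω : Set (E n)) : Type := sobolevH1 Ω

/-- The function underlying an element of `H¹(Ω)`. -/
def H1.val {Ω : Set (E n)} (u : H1 Ω) : L2 Ω := (u : WithLp 2 (L2 Ω × L2Vec Ω)).fst

/-- The weak gradient of an element of `H¹(Ω)`. -/
def H1.grad {Ω : Set (E n)} (u : H1 Ω) : L2Vec Ω := (u : WithLp 2 (L2 Ω × L2Vec Ω)).snd

lemma isClosed_sobolevH1 (Ω : Set (E n)) :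
    IsClosed (sobolevH1 Ω : Set (WithLp 2 (L2 Ω × L2Vec Ω))) := by
  have : (sobolevH1 Ω : Set (WithLp 2 (L2 Ω × L2Vec Ω))) =
      ⋂ (φ : E n → ℝ) (_ : ContDiff ℝ ∞ φ) (_ : HasCompactSupport φ) (_ : tsupport φ ⊆ Ω)
        (e : E n), {w : WithLp 2 (L2 Ω × L2Vec Ω) |
          ∫ x in Ω, w.fst x * fderiv ℝ φ x e = -∫ x in Ω, inner ℝ (w.snd x) e * φ x} := by
    ext w
    simp only [Set.mem_iInter]
    rfl
  rw [this]
  refine isClosed_iInter fun φ => isClosed_iInter fun hφ => isClosed_iInter fun hc =>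
    isClosed_iInter fun _ => isClosed_iInter fun e => ?_
  obtain ⟨Λ, hΛ⟩ := exists_weakGradient_functional Ω hφ hc e
  simp only [hΛ]
  exact isClosed_eq Λ.continuous continuous_const

instance instCompleteSpaceH1 (Ω : Set (E n)) : CompleteSpace (H1 Ω) :=
  (isClosed_sobolevH1 Ω).completeSpace_coe

/-! ### Traces and `H^{1/2}(Γ)` -/

/-- The pairs `(φ|_Ω, φ|_Γ)` in `H¹(Ω) × L²(Γ)`, for `φ` smooth and compactly supported in `ℝⁿ`. -/
def smoothTracePairs (Ω Γ : Set (E n)) : Submodule ℝ (H1 Ω × Lp ℝ 2 (surfaceMeasure Γ)) where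
  carrier := {w | ∃ φ : E n → ℝ, ContDiff ℝ ∞ φ ∧ HasCompactSupport φ ∧
    w.1.val =ᵐ[volume.restrict Ω] φ ∧ w.2 =ᵐ[surfaceMeasure Γ] φ}
  add_mem' := by
    rintro v w ⟨φ, hφ, hc, h1, h2⟩ ⟨ψ, hψ, hd, k1, k2⟩
    exact ⟨φ + ψ, hφ.add hψ, hc.add hd, (Lp.coeFn_add _ _).trans (h1.add k1),
      (Lp.coeFn_add _ _).trans (h2.add k2)⟩
  zero_mem' := ⟨0, contDiff_const, HasCompactSupport.zero, Lp.coeFn_zero _ _ _,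
    Lp.coeFn_zero _ _ _⟩
  smul_mem' := by
    rintro c w ⟨φ, hφ, hc, h1, h2⟩
    exact ⟨c • φ, contDiff_const.smul hφ, hc.smul_left (f := fun _ => c),
      (Lp.coeFn_smul _ _).trans (h1.const_smul c), (Lp.coeFn_smul _ _).trans (h2.const_smul c)⟩

/-- The graph of `u ↦ (γ₀ u)|_Γ` in `H¹(Ω) × L²(Γ)`: the trace is the continuous extension to
`H¹(Ω)` of the restriction `φ ↦ φ|_Γ` of smooth functions. -/
def traceGraph (Ω Γ : Set (E n)) : Submodule ℝ (H1 Ω × Lp ℝ 2 (surfaceMeasure Γ)) :=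
  (smoothTracePairs Ω Γ).topologicalClosure

/-- The functions of `H¹(Ω)` whose trace vanishes almost everywhere on `Γ`. -/
def traceKer (Ω Γ : Set (E n)) : Submodule ℝ (H1 Ω) :=
  (traceGraph Ω Γ).comap (LinearMap.inl ℝ (H1 Ω) (Lp ℝ 2 (surfaceMeasure Γ)))

instance isClosed_traceKer (Ω Γ : Set (E n)) : IsClosed (traceKer Ω Γ : Set (H1 Ω)) :=
  (Submodule.isClosed_topologicalClosure (smoothTracePairs Ω Γ)).preimage
    (f := fun u : H1 Ω => (u, (0 : Lp ℝ 2 (surfaceMeasure Γ))))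
    (continuous_id.prodMk continuous_const)

/-- `H^{1/2}(Γ)`, the space of traces on `Γ` of functions of `H¹(Ω)` with its quotient norm
`‖g‖ = inf {‖u‖_{H¹(Ω)} : γ₀ u = g on Γ}`. A trace is represented by the class of all functions of
`H¹(Ω)` that have this trace. -/
abbrev HHalf (Ω Γ : Set (E n)) : Type := H1 Ω ⧸ traceKer Ω Γ

/-- The boundary trace `χ_Γ γ₀ : H¹(Ω) → H^{1/2}(Γ)`. -/
def boundaryTrace (Ω Γ : Set (E n)) : H1 Ω →L[ℝ] HHalf Ω Γ := (traceKer Ω Γ).mkQL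

end Sobolev

/-! ### Strongly continuous semigroups -/

section Semigroup

variable {X : Type*} [NormedAddCommGroup X] [NormedSpace ℝ X]

/-- `(S t)_{t ≥ 0}` is a strongly continuous semigroup of bounded operators on `X`
(the values at negative times are irrelevant). -/
structure IsC0Semigroup (S : ℝ → X →L[ℝ] X) : Prop where
  map_zero : S 0 = ContinuousLinearMap.id ℝ X
  map_add : ∀ s t : ℝ, 0 ≤ s → 0 ≤ t → S (s + t) = (S s).comp (S t)
  continuousOn : ∀ x : X, ContinuousOn (fun t => S t x) (Set.Ici 0)

/-- The (possibly unbounded) operator with graph `A` is the generator of `S`: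
`(x, y)` is in the graph iff `(S t x - x) / t → y` as `t → 0⁺`. -/
def IsGenerator (A : Set (X × X)) (S : ℝ → X →L[ℝ] X) : Prop :=
  ∀ x y : X, (x, y) ∈ A ↔ Tendsto (fun t : ℝ => t⁻¹ • (S t x - x)) (𝓝[>] 0) (𝓝 y)

/-- The mild solution `S t x₀ + ∫₀ᵗ S (t - τ) f(τ) dτ`, for `t ≥ 0`, of `x' = A x + f`,
`x(0) = x₀`, where `A` generates `S`. -/
def mildSolution (S : ℝ → X →L[ℝ] X) (x₀ : X) (f : ℝ → X) (t : ℝ) : X :=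
  S t x₀ + ∫ τ in (0 : ℝ)..t, S (t - τ) (f τ)

end Semigroup

/-! ### The parabolic system, its detectability and its estimators -/

/-- The data of the parabolic system
`∂x/∂t = A x + B u` in `Ω × (0, ∞)`, `∂x/∂ν_A = 0` on `∂Ω × (0, ∞)`, `y = C x`,
where `A x = ∑ i j, ∂ᵢ (a i j ∂ⱼ x) + a₀ x` is a second-order, formally self-adjoint, uniformly
elliptic operator. There are `p` actuators and `q` sensors. -/
structure ParabolicSystem (n p q : ℕ) where
  Ω : Set (E n)
  regular : IsRegularDomain Ω
  a : E n → Matrix (Fin n) (Fin n) ℝ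
  a₀ : E n → ℝ
  measurable_a : ∀ i j, Measurable fun ξ => a ξ i j
  measurable_a₀ : Measurable a₀
  bounded_a : ∃ K : ℝ, ∀ ξ ∈ Ω, ∀ i j, |a ξ i j| ≤ K
  bounded_a₀ : ∃ K : ℝ, ∀ ξ ∈ Ω, |a₀ ξ| ≤ K
  symmetric : ∀ ξ ∈ Ω, (a ξ).IsSymm
  elliptic : ∃ c > 0, ∀ ξ ∈ Ω, ∀ η : Fin n → ℝ, c * ∑ i, η i ^ 2 ≤ ∑ i, ∑ j, a ξ i j * η i * η j
  B : E p →L[ℝ] H1 Ω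
  C : H1 Ω →L[ℝ] E q

namespace ParabolicSystem

variable {n p q : ℕ} (P : ParabolicSystem n p q)

/-- The graph of `A` in `H¹(Ω)`, with the Neumann condition `∂x/∂ν_A = 0` in its domain. As usual,
the equation `A x = f` and the Neumann condition together are expressed by Green's formula
`-∫ ∑ i j, a i j ∂ⱼ x ∂ᵢ v + ∫ a₀ x v = ∫ f v` for all `v ∈ H¹(Ω)`. -/
def neumannOperator : Set (H1 P.Ω × H1 P.Ω) :=
  {w | ∀ v : H1 P.Ω,
    -(∫ ξ in P.Ω, ∑ i, ∑ j, P.a ξ i j * w.1.grad ξ j * v.grad ξ i)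
      + ∫ ξ in P.Ω, P.a₀ ξ * w.1.val ξ * v.val ξ = ∫ ξ in P.Ω, w.2.val ξ * v.val ξ}

/-- The graph of `A - H C`, with domain that of `A`. -/
def feedbackOperator (H : E q →L[ℝ] H1 P.Ω) : Set (H1 P.Ω × H1 P.Ω) :=
  {w | (w.1, w.2 + H (P.C w.1)) ∈ P.neumannOperator}

/-- The semigroup `S` is exponentially stable on `Γ`:
`‖χ_Γ γ₀ S(t)‖ ≤ M e^{-α t}` for all `t ≥ 0`, with `M, α > 0`. -/
def IsExpStableOn (Γ : Set (E n)) (S : ℝ → H1 P.Ω →L[ℝ] H1 P.Ω) : Prop :=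
  ∃ M > 0, ∃ α > 0, ∀ t : ℝ, 0 ≤ t →
    ‖(boundaryTrace P.Ω Γ).comp (S t)‖ ≤ M * Real.exp (-α * t)

/-- The gain `HΓ : ℝ^q → H^{1/2}(Γ)` makes the system exponentially detectable on `Γ`: realized in
the state space by an operator `H : ℝ^q → H¹(Ω)` with trace `HΓ` on `Γ`, it is such that `A - H C`
generates a strongly continuous semigroup `S`, which is exponentially stable on `Γ`. -/
structure IsDetectingGain (Γ : Set (E n)) (HΓ : E q →L[ℝ] HHalf P.Ω Γ)
    (H : E q →L[ℝ] H1 P.Ω) (S : ℝ → H1 P.Ω →L[ℝ] H1 P.Ω) : Prop where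
  trace_eq : (boundaryTrace P.Ω Γ).comp H = HΓ
  semigroup : IsC0Semigroup S
  generator : IsGenerator (P.feedbackOperator H) S
  stable : P.IsExpStableOn Γ S

/-- The system is (full-order) exponentially detectable on `Γ`. -/
def IsDetectable (Γ : Set (E n)) : Prop :=
  ∃ (HΓ : E q →L[ℝ] HHalf P.Ω Γ) (H : E q →L[ℝ] H1 P.Ω) (S : ℝ → H1 P.Ω →L[ℝ] H1 P.Ω),
    P.IsDetectingGain Γ HΓ H S

/-- The state `x(t)` for the initial state `x₀` and the control `u`;
`SA` is the semigroup generated by `A`. -/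
def state (SA : ℝ → H1 P.Ω →L[ℝ] H1 P.Ω) (x₀ : H1 P.Ω) (u : ℝ → E p) : ℝ → H1 P.Ω :=
  mildSolution SA x₀ fun τ => P.B (u τ)

/-- The output `y(t) = C x(t)`. -/
def output (SA : ℝ → H1 P.Ω →L[ℝ] H1 P.Ω) (x₀ : H1 P.Ω) (u : ℝ → E p) (t : ℝ) : E q :=
  P.C (P.state SA x₀ u t)

/-- The state `ẑ(t)` of the Luenberger system `ẑ' = A ẑ + B u + H (y - C ẑ)`, `ẑ(0) = z₀`, with the
Neumann condition, driven by `u` and by a function `y`. Equivalently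
`ẑ' = (A - H C) ẑ + B u + H y`; `S` is the semigroup generated by `A - H C`. -/
def luenberger (H : E q →L[ℝ] H1 P.Ω) (S : ℝ → H1 P.Ω →L[ℝ] H1 P.Ω) (z₀ : H1 P.Ω)
    (u : ℝ → E p) (y : ℝ → E q) : ℝ → H1 P.Ω :=
  mildSolution S z₀ fun τ => P.B (u τ) + H (y τ)

/-- The Luenberger system with gain `H` is a full-order exponential estimator on `Γ`: for all
controls `u ∈ L²(0, ∞; ℝᵖ)`, all initial states `x₀` of the system and `z₀` of the estimator, the
trace on `Γ` of `x(t) - ẑ(t)` tends to `0` in `H^{1/2}(Γ)`, and it does so exponentially, with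
constants that depend neither on `u` nor on the initial states. -/
def IsEstimator (Γ : Set (E n)) (SA : ℝ → H1 P.Ω →L[ℝ] H1 P.Ω)
    (H : E q →L[ℝ] H1 P.Ω) (S : ℝ → H1 P.Ω →L[ℝ] H1 P.Ω) : Prop :=
  ∃ M > 0, ∃ α > 0, ∀ u : ℝ → E p, MemLp u 2 (volume.restrict (Set.Ioi 0)) →
    ∀ x₀ z₀ : H1 P.Ω,
      (∀ t : ℝ, 0 ≤ t →
        ‖boundaryTrace P.Ω Γ
            (P.state SA x₀ u t - P.luenberger H S z₀ u (P.output SA x₀ u) t)‖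
          ≤ M * Real.exp (-α * t) * ‖x₀ - z₀‖) ∧
      Tendsto (fun t : ℝ => ‖boundaryTrace P.Ω Γ
            (P.state SA x₀ u t - P.luenberger H S z₀ u (P.output SA x₀ u) t)‖)
        atTop (𝓝 0)

end ParabolicSystem

end RegionalBoundary

end

namespace RegionalBoundary

/-! ### Strongly continuous semigroups and bounded perturbations of generators. -/

section Semigroup

variable {X : Type*} [NormedAddCommGroup X] [NormedSpace ℝ X]

/-! The estimation error satisfies `x(t) - ẑ(t) = S_H(t) (x₀ - ẑ₀)`: the control cancels. Taking the
trace, the stability estimate of the detecting gain is then the claim, with the same `M` and `α`.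

Formally the error solves `e' = (A - HC) e`, but both states are only mild solutions, so the
identity is proved on integral formulas. Write `T` for the semigroup of `A`, `S` for that of `A -
HC`, and `K = HC`. Duhamel's formula `∫₀ᵗ S(t-τ) K T(τ) x dτ = T(t) x - S(t) x`
(`integral_eq_sub_of_isPerturbation`) comes from differentiating `τ ↦ S(t-τ) T(τ) x` for `x` in the
domain, then from density of the domain. Inserting the mild solution for `T` into the one for `S`
gives a double integral; Fubini and Duhamel's formula collapse it (`mildSolution_sub_mildSolution`).

Semigroups are extended to negative times by the identity, so that orbits are continuous on all of
`ℝ`. -/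

lemma norm_mkQL_apply_le (K : Submodule ℝ X) {S : X →L[ℝ] X} {c : ℝ}
    (h : ‖K.mkQL.comp S‖ ≤ c) (x : X) : ‖K.mkQL (S x)‖ ≤ c * ‖x‖ :=
  ContinuousLinearMap.le_of_opNorm_le _ h x

/-- The extension of a semigroup to negative times by its value at `0`. -/
def extendLeft (S : ℝ → X →L[ℝ] X) (t : ℝ) : X →L[ℝ] X := S (max t 0)

lemma extendLeft_of_nonneg (S : ℝ → X →L[ℝ] X) {t : ℝ} (ht : 0 ≤ t) : extendLeft S t = S t := by
  rw [extendLeft, max_eq_left ht]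

lemma mildSolution_eq_extendLeft (S : ℝ → X →L[ℝ] X) (x₀ : X) (f : ℝ → X) {t : ℝ} (ht : 0 ≤ t) :
    mildSolution S x₀ f t = extendLeft S t x₀ + ∫ τ in (0 : ℝ)..t, extendLeft S (t - τ) (f τ) := by
  rw [mildSolution, extendLeft_of_nonneg S ht]
  congr 1
  refine intervalIntegral.integral_congr fun τ hτ => ?_
  rw [Set.uIcc_of_le ht] at hτ
  simp only [extendLeft_of_nonneg S (sub_nonneg.2 hτ.2)]

/-- Slopes at `0⁺` of `S t x`, with `y` as limit. -/
def HasInitialSlope (S : ℝ → X →L[ℝ] X) (x y : X) : Prop :=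
  Tendsto (fun t : ℝ => t⁻¹ • (S t x - x)) (𝓝[>] 0) (𝓝 y)

lemma HasInitialSlope.smul {S : ℝ → X →L[ℝ] X} {x y : X} (h : HasInitialSlope S x y) (c : ℝ) :
    HasInitialSlope S (c • x) (c • y) := by
  refine (Tendsto.const_smul h c).congr fun t => ?_
  rw [map_smul, ← smul_sub, smul_comm]

/-- The generator of `T` is the perturbation by `K` of the generator of `S`. -/
def IsPerturbation (S T : ℝ → X →L[ℝ] X) (K : X →L[ℝ] X) : Prop :=
  ∀ x y : X, HasInitialSlope S x y ↔ HasInitialSlope T x (y + K x)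

namespace IsC0Semigroup

variable {S T : ℝ → X →L[ℝ] X}

lemma extendLeft_add (hS : IsC0Semigroup S) {s t : ℝ} (hs : 0 ≤ s) (ht : 0 ≤ t) (x : X) :
    extendLeft S (s + t) x = extendLeft S s (extendLeft S t x) := by
  rw [extendLeft_of_nonneg S hs, extendLeft_of_nonneg S ht,
    extendLeft_of_nonneg S (add_nonneg hs ht), hS.map_add s t hs ht]
  rfl

lemma extendLeft_zero (hS : IsC0Semigroup S) (x : X) : extendLeft S 0 x = x := by
  rw [extendLeft_of_nonneg S le_rfl, hS.map_zero]
  rfl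

lemma continuous_orbit (hS : IsC0Semigroup S) (x : X) : Continuous fun t => extendLeft S t x :=
  (hS.continuousOn x).comp_continuous (continuous_id.max continuous_const)
    fun _ => Set.mem_Ici.2 (le_max_right _ _)

/-- The orbit of a point with an initial slope has right slopes at all times. -/
lemma hasInitialSlope_apply (hS : IsC0Semigroup S) {x y : X} (h : HasInitialSlope S x y) {t : ℝ}
    (ht : 0 ≤ t) : HasInitialSlope S (S t x) (S t y) := by
  refine (((S t).continuous.tendsto y).comp h).congr' ?_
  filter_upwards [self_mem_nhdsWithin] with k hk
  have e : S k (S t x) = S t (S k x) := by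
    rw [← ContinuousLinearMap.comp_apply, ← hS.map_add k t (le_of_lt hk) ht, add_comm,
      hS.map_add t k ht (le_of_lt hk), ContinuousLinearMap.comp_apply]
  simp [e]

variable [CompleteSpace X]

/-- Uniform boundedness principle: each orbit is bounded on a compact time interval. Negative times
are covered too, since they carry the value at `0`. -/
lemma exists_norm_le (hS : IsC0Semigroup S) (t : ℝ) :
    ∃ C, 0 ≤ C ∧ ∀ s ≤ t, ‖extendLeft S s‖ ≤ C := by
  obtain ⟨C, hC⟩ := banach_steinhaus (g := fun s : Set.Icc 0 (max t 0) => S s) fun x => by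
    obtain ⟨C, hC⟩ := isCompact_Icc.exists_bound_of_continuousOn
      ((hS.continuousOn x).mono (Set.Icc_subset_Ici_self : Set.Icc 0 (max t 0) ⊆ _))
    exact ⟨C, fun s => hC s s.2⟩
  have h (s : ℝ) (hs : s ≤ t) : ‖extendLeft S s‖ ≤ C :=
    hC ⟨max s 0, le_max_right _ _, max_le_max hs le_rfl⟩
  exact ⟨C, (norm_nonneg _).trans (h t le_rfl), h⟩

/-- A strongly continuous semigroup is jointly continuous in time and state. -/
lemma continuous_extendLeft (hS : IsC0Semigroup S) :
    Continuous fun z : ℝ × X => extendLeft S z.1 z.2 := by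
  refine continuous_iff_continuousAt.2 fun ⟨t, x⟩ => ?_
  obtain ⟨C, -, hC⟩ := hS.exists_norm_le (t + 1)
  have h1 : Tendsto (fun z : ℝ × X => extendLeft S z.1 (z.2 - x)) (𝓝 (t, x)) (𝓝 0) := by
    have h0 : Tendsto (fun z : ℝ × X => C * ‖z.2 - x‖) (𝓝 (t, x)) (𝓝 0) := by
      have : Continuous fun z : ℝ × X => C * ‖z.2 - x‖ := by fun_prop
      simpa using this.tendsto (t, x)
    refine squeeze_zero_norm' ?_ h0
    filter_upwards [continuous_fst.continuousAt.preimage_mem_nhds (Iic_mem_nhds (lt_add_one t))]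
      with z hz
    exact (extendLeft S z.1).le_of_opNorm_le (hC _ hz) _
  have h2 : Tendsto (fun z : ℝ × X => extendLeft S z.1 x) (𝓝 (t, x)) (𝓝 (extendLeft S t x)) :=
    ((hS.continuous_orbit x).comp continuous_fst).tendsto (t, x)
  simpa [ContinuousAt] using h1.add h2

lemma _root_.Continuous.extendLeft_apply {Y : Type*} [TopologicalSpace Y] (hS : IsC0Semigroup S)
    {r : Y → ℝ} {g : Y → X} (hr : Continuous r) (hg : Continuous g) :
    Continuous fun y => extendLeft S (r y) (g y) :=
  hS.continuous_extendLeft.comp (hr.prodMk hg)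

/-- Time integrals of orbits lie in the domain of the generator. -/
lemma hasInitialSlope_integral (hS : IsC0Semigroup S) (x : X) {h : ℝ} (hh : 0 ≤ h) :
    HasInitialSlope S (∫ s in (0 : ℝ)..h, extendLeft S s x) (extendLeft S h x - x) := by
  have hc := hS.continuous_orbit x
  have hi (a b : ℝ) : IntervalIntegrable (fun s => extendLeft S s x) volume a b :=
    hc.intervalIntegrable a b
  set F : ℝ → X := fun u => ∫ s in (0 : ℝ)..u, extendLeft S s x with hF
  have hd (u : ℝ) : HasDerivAt F (extendLeft S u x) u :=
    intervalIntegral.integral_hasDerivAt_right (hi _ _)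
      (hc.stronglyMeasurableAtFilter _ _) hc.continuousAt
  have key := (hd h).tendsto_slope_zero_right.sub (hd 0).tendsto_slope_zero_right
  rw [hS.extendLeft_zero] at key
  refine key.congr' ?_
  filter_upwards [self_mem_nhdsWithin] with k hk
  have hk0 : 0 ≤ k := le_of_lt hk
  -- `S k` shifts the window of integration from `[0, h]` to `[k, h + k]`, so the quotient becomes a
  -- difference of two slopes of the primitive `F`, at `h` and at `0`.
  have e : S k (F h) = F (h + k) - F k := by
    rw [hF]
    simp only
    rw [intervalIntegral.integral_interval_sub_left (hi _ _) (hi _ _),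
      ← extendLeft_of_nonneg S hk0, ← ContinuousLinearMap.intervalIntegral_comp_comm _ (hi _ _)]
    have := intervalIntegral.integral_comp_add_left (fun s => extendLeft S s x) k (a := 0) (b := h)
    rw [add_zero, add_comm k h] at this
    rw [← this]
    refine intervalIntegral.integral_congr fun s hs => ?_
    rw [Set.uIcc_of_le hh] at hs
    exact (hS.extendLeft_add hk0 hs.1 x).symm
  have e0 : F 0 = 0 := by simp [hF]
  change _ = k⁻¹ • (S k (F h) - F h)
  rw [e, zero_add, e0, ← smul_sub]
  congr 1
  abel

/-! ### Duhamel's formula. -/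

/-- Variation of constants, for initial states in the domain of the generator. -/
lemma integral_eq_of_hasInitialSlope (hS : IsC0Semigroup S) (hT : IsC0Semigroup T)
    {K : X →L[ℝ] X} (hK : IsPerturbation S T K) {x y : X} (hx : HasInitialSlope T x y) {t : ℝ}
    (ht : 0 ≤ t) :
    ∫ τ in (0 : ℝ)..t, extendLeft S (t - τ) (K (extendLeft T τ x))
      = extendLeft T t x - extendLeft S t x := by
  have hTc := hT.continuous_orbit x
  have hcont : Continuous fun τ => extendLeft S (t - τ) (extendLeft T τ x) :=
    Continuous.extendLeft_apply hS (by fun_prop) hTc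
  have hint : Continuous fun τ => extendLeft S (t - τ) (K (extendLeft T τ x)) :=
    Continuous.extendLeft_apply hS (by fun_prop) (K.continuous.comp hTc)
  -- Initial slopes are one-sided, so the fundamental theorem of calculus is used with right
  -- derivatives of `τ ↦ S(t-τ) T(τ) x`.
  rw [intervalIntegral.integral_eq_sub_of_hasDeriv_right_of_le ht hcont.continuousOn ?_
    (hint.intervalIntegrable _ _)]
  · simp [hS.extendLeft_zero, hT.extendLeft_zero]
  intro τ hτ
  rw [hasDerivWithinAt_iff_tendsto_slope' (by simp)]
  have hmap : 𝓝[>] τ = Filter.map (fun k => τ + k) (𝓝[>] 0) := by simp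
  rw [hmap, tendsto_map'_iff]
  set z := extendLeft T τ x with hz
  have hzT : HasInitialSlope T z (extendLeft T τ y) := by
    rw [hz, extendLeft_of_nonneg T hτ.1.le]
    exact hT.hasInitialSlope_apply hx hτ.1.le
  have hzS : HasInitialSlope S z (extendLeft T τ y - K z) := (hK _ _).2 (by simpa using hzT)
  have hdiff : Tendsto (fun k : ℝ => k⁻¹ • (T k z - S k z)) (𝓝[>] 0) (𝓝 (K z)) := by
    have := Tendsto.sub hzT hzS
    rw [sub_sub_cancel] at this
    refine this.congr fun k => ?_
    rw [← smul_sub]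
    congr 1
    abel
  have htime : Tendsto (fun k : ℝ => t - τ - k) (𝓝[>] 0) (𝓝 (t - τ)) := by
    have : Continuous fun k : ℝ => t - τ - k := by fun_prop
    simpa using (this.tendsto 0).mono_left nhdsWithin_le_nhds
  -- The difference quotient equals `S(t-τ-k)` applied to `k⁻¹ (T(k) z - S(k) z)`; time and vector
  -- both vary, hence the need for joint continuity.
  refine ((hS.continuous_extendLeft.tendsto (t - τ, K z)).comp (htime.prodMk_nhds hdiff)).congr' ?_
  filter_upwards [Ioo_mem_nhdsGT (sub_pos.2 hτ.2)] with k hk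
  have e1 : extendLeft T (τ + k) x = T k z := by
    rw [add_comm, hT.extendLeft_add hk.1.le hτ.1.le, extendLeft_of_nonneg T hk.1.le]
  have e2 : extendLeft S (t - τ) z = extendLeft S (t - τ - k) (S k z) := by
    rw [← extendLeft_of_nonneg S hk.1.le, ← hS.extendLeft_add (sub_nonneg.2 hk.2.le) hk.1.le,
      sub_add_cancel]
  simp only [Function.comp_apply, slope, vsub_eq_sub, add_sub_cancel_left]
  rw [e1, ← hz, e2, ← sub_sub, ← map_sub, map_smul]

/-- **Variation of constants**: Duhamel's formula for a bounded perturbation of a generator. -/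
theorem integral_eq_sub_of_isPerturbation (hS : IsC0Semigroup S) (hT : IsC0Semigroup T)
    {K : X →L[ℝ] X} (hK : IsPerturbation S T K) (x : X) {t : ℝ} (ht : 0 ≤ t) :
    ∫ τ in (0 : ℝ)..t, extendLeft S (t - τ) (K (extendLeft T τ x))
      = extendLeft T t x - extendLeft S t x := by
  -- The mean of the orbit over `[0, h]`, rescaled to `[0, 1]` so that it is continuous in `h` with
  -- value `x` at `h = 0`. For `h > 0` it lies in the domain of the generator of `T`.
  set γ : ℝ → X := fun h => ∫ s in (0 : ℝ)..1, extendLeft T (h * s) x with hγ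
  have hγc : Continuous γ := by
    refine intervalIntegral.continuous_parametric_intervalIntegral_of_continuous' ?_ 0 1
    exact (hT.continuous_orbit x).comp (continuous_fst.mul continuous_snd)
  have hγ0 : γ 0 = x := by simp [hγ, hT.extendLeft_zero]
  have hslope (h : ℝ) (hh : 0 < h) : ∃ y, HasInitialSlope T (γ h) y := by
    have e : γ h = h⁻¹ • ∫ s in (0 : ℝ)..h, extendLeft T s x := by
      rw [hγ]
      simp only
      rw [intervalIntegral.integral_comp_mul_left (fun s => extendLeft T s x) hh.ne']
      simp
    rw [e]
    exact ⟨_, (hT.hasInitialSlope_integral x hh.le).smul h⁻¹⟩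
  have hL : Continuous fun h =>
      ∫ τ in (0 : ℝ)..t, extendLeft S (t - τ) (K (extendLeft T τ (γ h))) := by
    refine intervalIntegral.continuous_parametric_intervalIntegral_of_continuous' ?_ 0 t
    exact Continuous.extendLeft_apply hS (by fun_prop) (K.continuous.comp
      (Continuous.extendLeft_apply hT continuous_snd (hγc.comp continuous_fst)))
  have hR : Continuous fun h => extendLeft T t (γ h) - extendLeft S t (γ h) := by fun_prop
  have hLim := (hL.tendsto 0).mono_left (nhdsWithin_le_nhds (s := Set.Ioi 0))
  have hRim := (hR.tendsto 0).mono_left (nhdsWithin_le_nhds (s := Set.Ioi 0))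
  rw [hγ0] at hLim hRim
  refine tendsto_nhds_unique hLim (hRim.congr' ?_)
  filter_upwards [self_mem_nhdsWithin] with h hh
  obtain ⟨y, hy⟩ := hslope h hh
  exact (hS.integral_eq_of_hasInitialSlope hT hK hy ht).symm

/-! ### Convolutions with a forcing term, and Fubini. -/

lemma intervalIntegrable_convolution (hS : IsC0Semigroup S) {f : ℝ → X} {t : ℝ} (ht : 0 ≤ t)
    (hf : IntegrableOn f (Set.Ioc 0 t)) :
    IntervalIntegrable (fun τ => extendLeft S (t - τ) (f τ)) volume 0 t := by
  rw [intervalIntegrable_iff_integrableOn_Ioc_of_le ht]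
  obtain ⟨C, -, hC⟩ := hS.exists_norm_le t
  refine Integrable.mono' (hf.norm.const_mul C) ?_ ?_
  · exact hS.continuous_extendLeft.comp_aestronglyMeasurable
      (f := fun τ => ((t - τ : ℝ), f τ))
      ((by fun_prop : Continuous fun τ : ℝ => t - τ).aestronglyMeasurable.prodMk
        hf.aestronglyMeasurable)
  · filter_upwards [ae_restrict_mem measurableSet_Ioc] with τ hτ
    exact (extendLeft S (t - τ)).le_of_opNorm_le (hC _ (by linarith [hτ.1])) _

/-- The kernel `S (t - τ) K T (τ - s) f(s)`, for `s ≤ τ`, of an iterated convolution. -/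
noncomputable def iteratedKernel (S T : ℝ → X →L[ℝ] X) (K : X →L[ℝ] X) (f : ℝ → X) (t : ℝ) :
    ℝ × ℝ → X :=
  {z : ℝ × ℝ | z.2 ≤ z.1}.indicator fun z =>
    extendLeft S (t - z.1) (K (extendLeft T (z.1 - z.2) (f z.2)))

lemma integrable_iteratedKernel (hS : IsC0Semigroup S) (hT : IsC0Semigroup T) (K : X →L[ℝ] X)
    {f : ℝ → X} {t : ℝ} (hf : IntegrableOn f (Set.Ioc 0 t)) :
    Integrable (iteratedKernel S T K f t)
      ((volume.restrict (Set.Ioc 0 t)).prod (volume.restrict (Set.Ioc 0 t))) := by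
  obtain ⟨C, hC0, hC⟩ := hS.exists_norm_le t
  obtain ⟨D, hD0, hD⟩ := hT.exists_norm_le t
  -- The indicator can be dropped: the bound for `T` also holds at negative times `z.1 - z.2`, so a
  -- multiple of `‖f z.2‖` dominates on the whole square.
  refine Integrable.indicator ?_ (isClosed_le continuous_snd continuous_fst).measurableSet
  refine Integrable.mono' ((hf.norm.const_mul (C * (‖K‖ * D))).comp_snd _) ?_ ?_
  · have hc : Continuous fun w : (ℝ × ℝ) × X =>
        extendLeft S (t - w.1.1) (K (extendLeft T (w.1.1 - w.1.2) w.2)) :=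
      Continuous.extendLeft_apply hS (by fun_prop) (K.continuous.comp
        (Continuous.extendLeft_apply hT (by fun_prop) continuous_snd))
    exact hc.comp_aestronglyMeasurable (f := fun z : ℝ × ℝ => (z, f z.2))
      (aestronglyMeasurable_id.prodMk hf.aestronglyMeasurable.comp_snd)
  · have hmem : ∀ᵐ z ∂((volume.restrict (Set.Ioc (0 : ℝ) t)).prod
        (volume.restrict (Set.Ioc (0 : ℝ) t))), z ∈ Set.Ioc 0 t ×ˢ Set.Ioc 0 t := by
      rw [Measure.prod_restrict]
      exact ae_restrict_mem (measurableSet_Ioc.prod measurableSet_Ioc)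
    filter_upwards [hmem] with z hz
    have h1 := (extendLeft T (z.1 - z.2)).le_of_opNorm_le
      (hD _ (by linarith [hz.1.2, hz.2.1])) (f z.2)
    have h2 := (extendLeft S (t - z.1)).le_of_opNorm_le (hC _ (by linarith [hz.1.1]))
      (K (extendLeft T (z.1 - z.2) (f z.2)))
    calc _ ≤ C * ‖K (extendLeft T (z.1 - z.2) (f z.2))‖ := h2
      _ ≤ C * (‖K‖ * (D * ‖f z.2‖)) := by
        gcongr
        exact (K.le_opNorm _).trans (by gcongr)
      _ = C * (‖K‖ * D) * ‖f z.2‖ := by ring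

/-- Duhamel's formula on `[0, t - s]` for the vector `f s`, after the shift `r = τ - s`. -/
lemma integral_iteratedKernel_fst (hS : IsC0Semigroup S) (hT : IsC0Semigroup T) {K : X →L[ℝ] X}
    (hK : IsPerturbation S T K) (f : ℝ → X) {s t : ℝ} (hs : s ∈ Set.Ioc 0 t) :
    ∫ τ in Set.Ioc 0 t, iteratedKernel S T K f t (τ, s)
      = extendLeft T (t - s) (f s) - extendLeft S (t - s) (f s) := by
  have e (τ : ℝ) : iteratedKernel S T K f t (τ, s) = (Set.Ici s).indicator
      (fun τ => extendLeft S (t - τ) (K (extendLeft T (τ - s) (f s)))) τ := rfl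
  have hset : Set.Ioc 0 t ∩ Set.Ici s = Set.Icc s t := by
    ext τ
    simp only [Set.mem_inter_iff, Set.mem_Ioc, Set.mem_Ici, Set.mem_Icc]
    exact ⟨fun h => ⟨h.2, h.1.2⟩, fun h => ⟨⟨hs.1.trans_le h.1, h.2⟩, h.1⟩⟩
  simp_rw [e]
  rw [setIntegral_indicator measurableSet_Ici, hset, integral_Icc_eq_integral_Ioc,
    ← intervalIntegral.integral_of_le hs.2,
    ← hS.integral_eq_sub_of_isPerturbation hT hK (f s) (sub_nonneg.2 hs.2)]
  have := intervalIntegral.integral_comp_sub_right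
    (fun r => extendLeft S (t - s - r) (K (extendLeft T r (f s)))) s (a := s) (b := t)
  rw [sub_self] at this
  rw [← this]
  simp

/-- The bounded operator `S(t-τ) K` comes out of the integral. -/
lemma integral_iteratedKernel_snd (hT : IsC0Semigroup T) (K : X →L[ℝ] X) {f : ℝ → X} {τ t : ℝ}
    (hf : IntegrableOn f (Set.Ioc 0 t)) (hτ : τ ∈ Set.Ioc 0 t) :
    ∫ s in Set.Ioc 0 t, iteratedKernel S T K f t (τ, s)
      = extendLeft S (t - τ) (K (∫ s in (0 : ℝ)..τ, extendLeft T (τ - s) (f s))) := by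
  have e (s : ℝ) : iteratedKernel S T K f t (τ, s) = (Set.Iic τ).indicator
      (fun s => extendLeft S (t - τ) (K (extendLeft T (τ - s) (f s)))) s := rfl
  have hset : Set.Ioc 0 t ∩ Set.Iic τ = Set.Ioc 0 τ := by
    ext s
    simp only [Set.mem_inter_iff, Set.mem_Ioc, Set.mem_Iic]
    exact ⟨fun h => ⟨h.1.1, h.2⟩, fun h => ⟨⟨h.1, h.2.trans hτ.2⟩, h.2⟩⟩
  simp_rw [e]
  rw [setIntegral_indicator measurableSet_Iic, hset, ← intervalIntegral.integral_of_le hτ.1.le]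
  exact ((extendLeft S (t - τ)).comp K).intervalIntegral_comp_comm
    (hT.intervalIntegrable_convolution hτ.1.le (hf.mono_set (Set.Ioc_subset_Ioc_right hτ.2)))

/-- The mild solution `x` of `x' = A x + f` is the mild solution of `x' = (A - K) x + (f + K x)`,
up to the propagated difference of the initial states. -/
theorem mildSolution_sub_mildSolution (hS : IsC0Semigroup S) (hT : IsC0Semigroup T)
    {K : X →L[ℝ] X} (hK : IsPerturbation S T K) {f : ℝ → X} {t : ℝ} (ht : 0 ≤ t)
    (hf : IntegrableOn f (Set.Ioc 0 t)) (x₀ z₀ : X) :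
    mildSolution T x₀ f t - mildSolution S z₀ (fun τ => f τ + K (mildSolution T x₀ f τ)) t
      = S t (x₀ - z₀) := by
  have hker := hS.integrable_iteratedKernel hT K hf
  have hcf := hS.intervalIntegrable_convolution ht hf
  have hch : IntervalIntegrable (fun τ => extendLeft S (t - τ) (K (extendLeft T τ x₀))) volume 0 t :=
    (Continuous.extendLeft_apply hS (by fun_prop)
      (K.continuous.comp (hT.continuous_orbit x₀))).intervalIntegrable _ _
  -- Integrability in `τ` comes from Fubini: the function is a partial integral of the integrable
  -- kernel.
  have hci : IntervalIntegrable (fun τ => extendLeft S (t - τ)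
      (K (∫ s in (0 : ℝ)..τ, extendLeft T (τ - s) (f s)))) volume 0 t := by
    rw [intervalIntegrable_iff_integrableOn_Ioc_of_le ht]
    refine hker.integral_prod_left.congr ?_
    filter_upwards [ae_restrict_mem measurableSet_Ioc] with τ hτ
    exact hT.integral_iteratedKernel_snd K hf hτ
  have hdouble : ∫ τ in (0 : ℝ)..t, extendLeft S (t - τ)
      (K (∫ s in (0 : ℝ)..τ, extendLeft T (τ - s) (f s)))
        = (∫ s in (0 : ℝ)..t, extendLeft T (t - s) (f s))
          - ∫ s in (0 : ℝ)..t, extendLeft S (t - s) (f s) := by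
    rw [← intervalIntegral.integral_sub (hT.intervalIntegrable_convolution ht hf) hcf,
      intervalIntegral.integral_of_le ht, intervalIntegral.integral_of_le ht,
      ← setIntegral_congr_fun measurableSet_Ioc
        (fun τ hτ => hT.integral_iteratedKernel_snd (S := S) K hf hτ),
      ← setIntegral_congr_fun measurableSet_Ioc
        (fun s hs => hS.integral_iteratedKernel_fst hT hK f hs)]
    exact integral_integral_swap hker
  have hsplit : ∫ τ in (0 : ℝ)..t, extendLeft S (t - τ) (f τ + K (mildSolution T x₀ f τ))
      = (∫ τ in (0 : ℝ)..t, extendLeft S (t - τ) (f τ))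
        + ((∫ τ in (0 : ℝ)..t, extendLeft S (t - τ) (K (extendLeft T τ x₀)))
          + ∫ τ in (0 : ℝ)..t, extendLeft S (t - τ)
            (K (∫ s in (0 : ℝ)..τ, extendLeft T (τ - s) (f s)))) := by
    rw [← intervalIntegral.integral_add hch hci, ← intervalIntegral.integral_add hcf (hch.add hci)]
    refine intervalIntegral.integral_congr fun τ hτ => ?_
    rw [Set.uIcc_of_le ht] at hτ
    simp only [mildSolution_eq_extendLeft T x₀ f hτ.1]
    rw [_root_.map_add, _root_.map_add, _root_.map_add]
  rw [mildSolution_eq_extendLeft T x₀ f ht, mildSolution_eq_extendLeft S z₀ _ ht, hsplit, hdouble,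
    hS.integral_eq_sub_of_isPerturbation hT hK x₀ ht, ← extendLeft_of_nonneg S ht, map_sub]
  abel

end IsC0Semigroup

end Semigroup

/-! ### The estimation error of the Luenberger system. -/

namespace ParabolicSystem

variable {n p q : ℕ} (P : ParabolicSystem n p q)

/-- By definition of the graph of `A - HC`, as `A = (A - HC) + HC` on the common domain. -/
lemma isPerturbation {SA S : ℝ → H1 P.Ω →L[ℝ] H1 P.Ω} {H : E q →L[ℝ] H1 P.Ω}
    (hA : IsGenerator P.neumannOperator SA) (hS : IsGenerator (P.feedbackOperator H) S) :
    IsPerturbation S SA (H.comp P.C) := fun x y =>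
  (hS x y).symm.trans (hA x (y + H (P.C x)))

lemma integrableOn_control {u : ℝ → E p} (hu : MemLp u 2 (volume.restrict (Set.Ioi 0))) (t : ℝ) :
    IntegrableOn (fun τ => P.B (u τ)) (Set.Ioc 0 t) := by
  have h : MemLp u 2 (volume.restrict (Set.Ioc 0 t)) :=
    hu.mono_measure (Measure.restrict_mono Set.Ioc_subset_Ioi_self le_rfl)
  exact P.B.integrable_comp (h.integrable one_le_two)

/-- The estimation error evolves by the semigroup generated by `A - H C`. -/
theorem state_sub_luenberger {SA S : ℝ → H1 P.Ω →L[ℝ] H1 P.Ω} {H : E q →L[ℝ] H1 P.Ω}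
    (hSA : IsC0Semigroup SA) (hA : IsGenerator P.neumannOperator SA) (hS : IsC0Semigroup S)
    (hF : IsGenerator (P.feedbackOperator H) S) {u : ℝ → E p}
    (hu : MemLp u 2 (volume.restrict (Set.Ioi 0))) (x₀ z₀ : H1 P.Ω) {t : ℝ} (ht : 0 ≤ t) :
    P.state SA x₀ u t - P.luenberger H S z₀ u (P.output SA x₀ u) t = S t (x₀ - z₀) :=
  hS.mildSolution_sub_mildSolution hSA (P.isPerturbation hA hF) ht (P.integrableOn_control hu t)
    x₀ z₀

theorem isEstimator_of_isDetectingGain {Γ : Set (E n)} {SA S : ℝ → H1 P.Ω →L[ℝ] H1 P.Ω}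
    {HΓ : E q →L[ℝ] HHalf P.Ω Γ} {H : E q →L[ℝ] H1 P.Ω} (hSA : IsC0Semigroup SA)
    (hA : IsGenerator P.neumannOperator SA) (h : P.IsDetectingGain Γ HΓ H S) :
    P.IsEstimator Γ SA H S := by
  obtain ⟨M, hM, α, hα, hstable⟩ := h.stable
  refine ⟨M, hM, α, hα, fun u hu x₀ z₀ => ?_⟩
  have hbound (t : ℝ) (ht : 0 ≤ t) : ‖boundaryTrace P.Ω Γ
      (P.state SA x₀ u t - P.luenberger H S z₀ u (P.output SA x₀ u) t)‖
        ≤ M * Real.exp (-α * t) * ‖x₀ - z₀‖ := by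
    rw [P.state_sub_luenberger hSA hA h.semigroup h.generator hu x₀ z₀ ht]
    exact norm_mkQL_apply_le (traceKer P.Ω Γ) (hstable t ht) _
  refine ⟨hbound, squeeze_zero' (.of_forall fun _ => norm_nonneg _)
    ((eventually_ge_atTop 0).mono hbound) ?_⟩
  have hexp : Tendsto (fun t : ℝ => Real.exp (-α * t)) atTop (𝓝 0) :=
    Real.tendsto_exp_atBot.comp (tendsto_id.const_mul_atTop_of_neg (neg_neg_of_pos hα))
  simpa using (hexp.const_mul M).mul_const ‖x₀ - z₀‖

end ParabolicSystem

end RegionalBoundary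

open RegionalBoundary in
theorem proposition4p1 {n p q : ℕ} (P : ParabolicSystem n p q) (Γ : Set (E n))
    (hΓ : IsBoundaryRegion P.Ω Γ)
    (SA : ℝ → H1 P.Ω →L[ℝ] H1 P.Ω) (hSA : IsC0Semigroup SA)
    (hA : IsGenerator P.neumannOperator SA)
    (hdet : P.IsDetectable Γ) :
    (∃ (HΓ : E q →L[ℝ] HHalf P.Ω Γ) (H : E q →L[ℝ] H1 P.Ω) (S : ℝ → H1 P.Ω →L[ℝ] H1 P.Ω),
      P.IsDetectingGain Γ HΓ H S ∧ P.IsEstimator Γ SA H S) ∧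
    ∀ (HΓ : E q →L[ℝ] HHalf P.Ω Γ) (H : E q →L[ℝ] H1 P.Ω) (S : ℝ → H1 P.Ω →L[ℝ] H1 P.Ω),
      P.IsDetectingGain Γ HΓ H S → P.IsEstimator Γ SA H S := by
  obtain ⟨HΓ, H, S, h⟩ := hdet
  exact ⟨⟨HΓ, H, S, h, P.isEstimator_of_isDetectingGain hSA hA h⟩,
    fun _ _ _ h => P.isEstimator_of_isDetectingGain hSA hA h⟩
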